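/- Let $\ell>3$ be a prime and let $k\ge 0$ be an even integer. Let $M_k(1)$ and $S_k(1)$ denote the spaces of (entire) modular forms and of cusp forms of weight $k$ for $\mathrm{SL}_2(\mathbb Z)$. For $\tau$ in the upper half plane put $q=e^{2\pi i\tau}$, let $\eta(\tau)=e^{\pi i\tau/12}\prod_{n\ge1}(1-q^n)$ be the Dedekind eta function, and let $$h_\ell(\tau)=\bigl(\eta(\tau)\,\eta(\ell\tau)\bigr)^{\ell-1}.$$ Let $U(\ell)$ be the operator on power series in $q$ given by $\bigl(\sum_{n\ge0}a(n)q^n\bigr)\mid U(\ell)=\sum_{n\ge0}a(\ell n)q^n$. Let $F\in M_k(1)$. Then $h_\ell F$ has a $q$-expansion $h_\ell(\tau)F(\tau)=\sum_{n\ge0}a(n)q^n$ that converges on the upper half plane, the series $(h_\ell F)\mid U(\ell)=\sum_{n\ge0}a(\ell n)q^n$ also converges there, and the function $$\bigl((h_\ell F)\mid U(\ell)\bigr)(\tau)+(-1)^{(\ell-1)/2}\,\ell^{\,k+(\ell-1)/2-1}\,h_\ell(\tau)\,F(\ell\tau)$$ belongs to $S_{k+\ell-1}(1)$. -/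

import Mathlib

open UpperHalfPlane ModularForm
open scoped MatrixGroups

/-- The function `h_ℓ(τ) = (η(τ) η(ℓτ)) ^ (ℓ - 1)` on the upper half plane. -/
noncomputable def hEll (ℓ : ℕ) (τ : ℍ) : ℂ :=
  (ModularForm.eta (τ : ℂ) * ModularForm.eta ((ℓ : ℂ) * (τ : ℂ))) ^ (ℓ - 1)

/-- The point `mτ` of the upper half plane, for a positive integer `m`. -/
def dilate (m : ℕ) (hm : 0 < m) (τ : ℍ) : ℍ :=
  ⟨(m : ℂ) * (τ : ℂ), by
    have h : (0 : ℝ) < m := Nat.cast_pos.mpr hm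
    simpa using mul_pos h τ.im_pos⟩

/-- The operator `U(m)` on formal power series: `(∑ a(n) qⁿ) | U(m) = ∑ a(mn) qⁿ`. -/
noncomputable def powerSeriesU (m : ℕ) (p : PowerSeries ℂ) : PowerSeries ℂ :=
  PowerSeries.mk fun n ↦ p.coeff (m * n)

/-- `p` is the `q`-expansion of `f`: for every `τ` in the upper half plane, the series
`∑ p(n) qⁿ` with `q = exp (2πiτ)` converges, and its sum is `f τ`. -/
def HasQExpansion (f : ℍ → ℂ) (p : PowerSeries ℂ) : Prop :=
  ∀ τ : ℍ, HasSum (fun n : ℕ ↦ p.coeff n * Function.Periodic.qParam 1 (τ : ℂ) ^ n) (f τ)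

/-!
The multiplier of `η ^ 2` is a character of `SL(2, ℤ)` of order `12`, and conjugation by
`diag(ℓ, 1)` raises it to the power `ℓ` when `ℓ` is prime to `6`. On `Γ₀(ℓ)` the function `h_ℓ`
therefore has the multiplier `χ ^ ((ℓ + 1) (ℓ - 1) / 2)`, which is trivial because `24` divides
`ℓ ^ 2 - 1`, and so `h_ℓ(τ) F(ℓτ)` is a cusp form of weight `k + ℓ - 1` on `Γ₀(ℓ)`. The asserted
function is `(-1) ^ ((ℓ - 1) / 2) ℓ ^ (k + (ℓ - 1) / 2 - 1)` times the trace of this form to level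
one: the identity coset contributes the second term, and since `S` carries `h_ℓ(τ) F(ℓτ)` to a
multiple of `h_ℓ(τ / ℓ) F(τ / ℓ)`, the cosets of `S T ^ j` contribute the average of `h_ℓ F` over
the points `(τ + j) / ℓ`, which is `(h_ℓ F) | U(ℓ)`.
-/

open CongruenceSubgroup
open scoped Manifold

section EtaSquared

/-- Dedekind's polynomial in the entries of a matrix of determinant `1`. Modulo `12` it is additive
in the matrix, and it is the exponent of the multiplier of `η ^ 2`. -/
def etaSqPhase {R : Type*} [CommRing R] (g : SL(2, R)) : R :=
  (1 - g 1 0 ^ 2) * (g 0 1 * g 1 1 + 3 * (g 1 0 - 1) * g 1 1 + g 1 0 + 3) +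
    g 1 0 * (g 0 0 + g 1 1 - 3)

lemma map_etaSqPhase {R S : Type*} [CommRing R] [CommRing S] (f : R →+* S) (g : SL(2, R)) :
    f (etaSqPhase g) = etaSqPhase (g.map f) := by
  simp [etaSqPhase, map_ofNat f 3]

lemma zmod_twelve_ext {x y : ZMod 12}
    (h₃ : ZMod.castHom (show 3 ∣ 12 by decide) (ZMod 3) x =
      ZMod.castHom (show 3 ∣ 12 by decide) (ZMod 3) y)
    (h₄ : ZMod.castHom (show 4 ∣ 12 by decide) (ZMod 4) x =
      ZMod.castHom (show 4 ∣ 12 by decide) (ZMod 4) y) : x = y := by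
  revert x y
  decide

lemma etaSqPhase_mul (g h : SL(2, ZMod 12)) :
    etaSqPhase (g * h) = etaSqPhase g + etaSqPhase h := by
  have h₃ : ∀ g h : SL(2, ZMod 3), etaSqPhase (g * h) = etaSqPhase g + etaSqPhase h := by
    decide +kernel
  have h₄ : ∀ g h : SL(2, ZMod 4), etaSqPhase (g * h) = etaSqPhase g + etaSqPhase h := by
    decide +kernel
  apply zmod_twelve_ext <;> simp only [map_add, map_etaSqPhase, map_mul, h₃, h₄]

/-- The matrix `g'` is the conjugate of `g` by `diag(u, 1)`. The equation for the lower left entry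
is solved for `g`, so that `u` need not be invertible. -/
structure IsDiagConj {R : Type*} [CommRing R] (u : R) (g g' : SL(2, R)) : Prop where
  zero_zero : g' 0 0 = g 0 0
  zero_one : g' 0 1 = u * g 0 1
  one_zero : g 1 0 = u * g' 1 0
  one_one : g' 1 1 = g 1 1

lemma IsDiagConj.map {R S : Type*} [CommRing R] [CommRing S] {u : R} {g g' : SL(2, R)}
    (h : IsDiagConj u g g') (f : R →+* S) : IsDiagConj (f u) (g.map f) (g'.map f) where
  zero_zero := by simp [h.zero_zero]
  zero_one := by simp [h.zero_one]
  one_zero := by simp [h.one_zero]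
  one_one := by simp [h.one_one]

lemma IsDiagConj.etaSqPhase_eq {u : ZMod 12} (hu : u ^ 2 = 1) {g g' : SL(2, ZMod 12)}
    (h : IsDiagConj u g g') : etaSqPhase g' = u * etaSqPhase g := by
  have h₃ : ∀ u : ZMod 3, u ^ 2 = 1 → ∀ g g' : SL(2, ZMod 3), g' 0 0 = g 0 0 →
      g' 0 1 = u * g 0 1 → g 1 0 = u * g' 1 0 → g' 1 1 = g 1 1 →
      etaSqPhase g' = u * etaSqPhase g := by
    decide +kernel
  have h₄ : ∀ u : ZMod 4, u ^ 2 = 1 → ∀ g g' : SL(2, ZMod 4), g' 0 0 = g 0 0 →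
      g' 0 1 = u * g 0 1 → g 1 0 = u * g' 1 0 → g' 1 1 = g 1 1 →
      etaSqPhase g' = u * etaSqPhase g := by
    decide +kernel
  apply zmod_twelve_ext <;> rw [map_mul, map_etaSqPhase, map_etaSqPhase]
  · obtain ⟨h00, h01, h10, h11⟩ := h.map (ZMod.castHom (show 3 ∣ 12 by decide) (ZMod 3))
    exact h₃ _ (by rw [← map_pow, hu, map_one]) _ _ h00 h01 h10 h11
  · obtain ⟨h00, h01, h10, h11⟩ := h.map (ZMod.castHom (show 4 ∣ 12 by decide) (ZMod 4))
    exact h₄ _ (by rw [← map_pow, hu, map_one]) _ _ h00 h01 h10 h11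

/-- The multiplier of `η ^ 2`, a character of `SL(2, ℤ)` of order `12`. -/
noncomputable def etaSqCharacter : SL(2, ℤ) →* ℂ where
  toFun γ := ZMod.stdAddChar (etaSqPhase (γ.map (Int.castRingHom (ZMod 12))))
  map_one' := by simp [etaSqPhase]
  map_mul' γ γ' := by rw [map_mul, etaSqPhase_mul, AddChar.map_add_eq_mul]

lemma etaSqCharacter_apply (γ : SL(2, ℤ)) :
    etaSqCharacter γ = ZMod.stdAddChar (etaSqPhase (γ.map (Int.castRingHom (ZMod 12)))) :=
  rfl

lemma etaSqCharacter_T :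
    etaSqCharacter ModularGroup.T = Complex.exp (2 * Real.pi * Complex.I / 12) := by
  have hphase : etaSqPhase (ModularGroup.T.map (Int.castRingHom (ZMod 12))) = 1 := by decide
  rw [etaSqCharacter_apply, hphase]
  simpa using ZMod.stdAddChar_coe (N := 12) 1

lemma etaSqCharacter_S : etaSqCharacter ModularGroup.S = -Complex.I := by
  have hphase : etaSqPhase (ModularGroup.S.map (Int.castRingHom (ZMod 12))) = (-3 : ℤ) := by decide
  rw [etaSqCharacter_apply, hphase, ZMod.stdAddChar_coe, ← Complex.exp_neg_pi_div_two_mul_I]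
  push_cast
  ring_nf

lemma etaSqCharacter_pow_twelve (γ : SL(2, ℤ)) : etaSqCharacter γ ^ 12 = 1 := by
  rw [etaSqCharacter_apply, ← AddChar.map_nsmul_eq_pow, nsmul_eq_mul,
    show ((12 : ℕ) : ZMod 12) = 0 from rfl, zero_mul, AddChar.map_zero_eq_one]

lemma IsDiagConj.etaSqCharacter_eq {m : ℕ} (hm : (m : ZMod 12) ^ 2 = 1) {γ γ' : SL(2, ℤ)}
    (h : IsDiagConj (m : ℤ) γ γ') : etaSqCharacter γ' = etaSqCharacter γ ^ m := by
  have h12 := h.map (Int.castRingHom (ZMod 12))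
  rw [map_natCast] at h12
  rw [etaSqCharacter_apply, h12.etaSqPhase_eq hm, ← nsmul_eq_mul, AddChar.map_nsmul_eq_pow,
    ← etaSqCharacter_apply]

lemma slash_eq_character_smul {f : ℍ → ℂ} {k : ℤ} (χ : SL(2, ℤ) →* ℂ)
    (hS : f ∣[k] ModularGroup.S = χ ModularGroup.S • f)
    (hT : f ∣[k] ModularGroup.T = χ ModularGroup.T • f) (γ : SL(2, ℤ)) :
    f ∣[k] γ = χ γ • f := by
  have hγ : γ ∈ Subgroup.closure {ModularGroup.S, ModularGroup.T} := by
    simp only [SpecialLinearGroup.SL2Z_generators, Subgroup.mem_top]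
  induction hγ using Subgroup.closure_induction with
  | mem g hg => rcases hg with rfl | rfl <;> assumption
  | one => simp
  | mul g h _ _ hg hh => rw [SlashAction.slash_mul, hg, SL_smul_slash, hh, smul_smul, map_mul]
  | inv g _ hg =>
    have hχ : χ g⁻¹ * χ g = 1 := by rw [← map_mul, inv_mul_cancel, map_one]
    calc f ∣[k] g⁻¹ = χ g⁻¹ • (χ g • f) ∣[k] g⁻¹ := by rw [SL_smul_slash, smul_smul, hχ, one_smul]
      _ = χ g⁻¹ • f := by rw [← hg, ← SlashAction.slash_mul, mul_inv_cancel, SlashAction.slash_one]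

/-- The square of the Dedekind eta function, as a function on the upper half plane. -/
noncomputable def etaSq (τ : ℍ) : ℂ := ModularForm.eta (τ : ℂ) ^ 2

lemma eta_one_add (z : ℂ) : ModularForm.eta (1 + z) =
    Complex.exp (2 * Real.pi * Complex.I / 24) * ModularForm.eta z := by
  have hq (w : ℂ) (h : ℝ) : Function.Periodic.qParam h (1 + w) =
      Complex.exp (2 * Real.pi * Complex.I / h) * Function.Periodic.qParam h w := by
    rw [Function.Periodic.qParam, Function.Periodic.qParam, ← Complex.exp_add]
    ring_nf
  simp [ModularForm.eta, ModularForm.eta_q, hq, Complex.exp_two_pi_mul_I, mul_assoc _ _ (tprod _)]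

lemma etaSq_slash_T : etaSq ∣[(1 : ℤ)] ModularGroup.T = etaSqCharacter ModularGroup.T • etaSq := by
  ext τ
  have hd : denom (ModularGroup.T : GL (Fin 2) ℝ) τ = 1 := by
    simp [ModularGroup.denom_apply, ModularGroup.coe_T]
  rw [SL_slash_apply, modular_T_smul, hd, etaSqCharacter_T, etaSq, coe_vadd, Complex.ofReal_one,
    eta_one_add, mul_pow, ← Complex.exp_nat_mul, one_zpow, mul_one, Pi.smul_apply, smul_eq_mul,
    etaSq]
  congr 2
  push_cast
  ring

lemma etaSq_S_smul (τ : ℍ) : etaSq (ModularGroup.S • τ) = -Complex.I * τ * etaSq τ := by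
  have hη : ModularForm.eta (-(τ : ℂ))⁻¹ =
      (Complex.sqrt Complex.I)⁻¹ * (Complex.sqrt τ * ModularForm.eta τ) := by
    simpa [neg_div, inv_neg] using ModularForm.eta_comp_eq_csqrt_I_inv τ.2
  have hsqrt (z : ℂ) : Complex.sqrt z ^ 2 = z := by simp [Complex.sqrt]
  rw [modular_S_smul, etaSq, coe_mk, hη, mul_pow, inv_pow, mul_pow, hsqrt, hsqrt, Complex.inv_I,
    mul_assoc, etaSq]

lemma etaSq_slash_S : etaSq ∣[(1 : ℤ)] ModularGroup.S = etaSqCharacter ModularGroup.S • etaSq := by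
  ext τ
  have := τ.ne_zero
  rw [SL_slash_apply, etaSq_S_smul, ModularGroup.denom_S, etaSqCharacter_S, Pi.smul_apply,
    smul_eq_mul, zpow_neg, zpow_one]
  field_simp

lemma etaSq_slash (γ : SL(2, ℤ)) : etaSq ∣[(1 : ℤ)] γ = etaSqCharacter γ • etaSq :=
  slash_eq_character_smul etaSqCharacter etaSq_slash_S etaSq_slash_T γ

end EtaSquared

section Dilation

variable {m : ℕ} {hm : 0 < m} {γ γ' : SL(2, ℤ)} {k : ℤ}

lemma coe_dilate (τ : ℍ) : (dilate m hm τ : ℂ) = m * τ := rfl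

lemma exists_isDiagConj (hγ : γ ∈ Gamma0 m) : ∃ γ', IsDiagConj (m : ℤ) γ γ' := by
  obtain ⟨c, hc⟩ := (ZMod.intCast_zmod_eq_zero_iff_dvd _ _).mp (Gamma0_mem.mp hγ)
  have hdet := γ.det_coe
  rw [Matrix.det_fin_two, hc] at hdet
  refine ⟨⟨!![γ 0 0, m * γ 0 1; c, γ 1 1], ?_⟩, rfl, rfl, hc, rfl⟩
  rw [Matrix.det_fin_two_of]
  linear_combination hdet

lemma IsDiagConj.dilate_smul (h : IsDiagConj (m : ℤ) γ γ') (τ : ℍ) :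
    dilate m hm (γ • τ) = γ' • dilate m hm τ := by
  ext
  simp only [coe_specialLinearGroup_apply, coe_dilate, h.zero_zero, h.zero_one, h.one_zero,
    h.one_one, algebraMap_int_eq, eq_intCast]
  push_cast
  ring

lemma IsDiagConj.denom_dilate (h : IsDiagConj (m : ℤ) γ γ') (τ : ℍ) :
    denom γ' (dilate m hm τ) = denom γ τ := by
  rw [ModularGroup.denom_apply, ModularGroup.denom_apply, coe_dilate, h.one_zero, h.one_one]
  push_cast
  ring

lemma IsDiagConj.comp_dilate_slash (h : IsDiagConj (m : ℤ) γ γ') (f : ℍ → ℂ) :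
    (f ∘ dilate m hm) ∣[k] γ = (f ∣[k] γ') ∘ dilate m hm := by
  ext τ
  simp only [SL_slash_apply, Function.comp_apply, h.dilate_smul, h.denom_dilate]

lemma mdifferentiable_comp_dilate {f : ℍ → ℂ} (hf : MDiff f) : MDiff (f ∘ dilate m hm) := by
  rw [UpperHalfPlane.mdifferentiable_iff] at hf ⊢
  have hmap : Set.MapsTo (fun z : ℂ ↦ (m : ℂ) * z) {z | 0 < z.im} {z | 0 < z.im} := fun z hz ↦ by
    simpa using mul_pos (Nat.cast_pos (α := ℝ).mpr hm) hz
  refine (hf.comp (by fun_prop) hmap).congr fun z hz ↦ ?_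
  simp only [Function.comp_apply, ofComplex_apply_of_im_pos hz,
    ofComplex_apply_of_im_pos (hmap hz)]
  rfl

variable (m hm) in
/-- The rational matrix `diag(m, 1)`, which acts on the upper half plane by `dilate m`. -/
noncomputable def dilateMatrix : GL (Fin 2) ℚ :=
  .mkOfDetNeZero !![(m : ℚ), 0; 0, 1] (by simpa using hm.ne')

lemma coe_dilateMatrix_map :
    ((dilateMatrix m hm).map (Rat.castHom ℝ) : Matrix (Fin 2) (Fin 2) ℝ) =
      !![(m : ℝ), 0; 0, 1] := by
  ext i j
  fin_cases i <;> fin_cases j <;> simp [dilateMatrix]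

lemma slash_dilateMatrix (f : ℍ → ℂ) :
    f ∣[k] (dilateMatrix m hm).map (Rat.castHom ℝ) = (m : ℝ) ^ (k - 1) • (f ∘ dilate m hm) := by
  set δ := (dilateMatrix m hm).map (Rat.castHom ℝ)
  have hδ : (δ : Matrix (Fin 2) (Fin 2) ℝ) = !![(m : ℝ), 0; 0, 1] := coe_dilateMatrix_map
  have hdet : δ.det.val = m := by simp [hδ]
  have hpos : 0 < δ.det.val := by simpa [hdet] using hm
  ext τ
  have hsmul : δ • τ = dilate m hm τ := by
    ext
    simp [coe_smul_of_det_pos hpos, num, denom, hδ, coe_dilate]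
  rw [slash_apply, hsmul, hdet]
  simp [σ, denom, hδ, mul_comm, hm]

lemma comp_dilate_slash_of_mem_Gamma0 (F : ModularForm 𝒮ℒ k) (hγ : γ ∈ Gamma0 m) :
    (F ∘ dilate m hm) ∣[k] γ = F ∘ dilate m hm := by
  obtain ⟨γ', h⟩ := exists_isDiagConj hγ
  have hF : (F : ℍ → ℂ) ∣[k] γ' = F := SlashInvariantFormClass.slash_action_eq F _ ⟨γ', rfl⟩
  rw [h.comp_dilate_slash, hF]

open scoped Pointwise in
lemma isBoundedAt_comp_dilate (F : ModularForm 𝒮ℒ k) {c : OnePoint ℝ} (hc : IsCusp c 𝒮ℒ) :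
    c.IsBoundedAt (F ∘ dilate m hm) k := by
  have hδ : (ConjAct.toConjAct ((dilateMatrix m hm).map (Rat.castHom ℝ))⁻¹ • 𝒮ℒ).IsArithmetic := by
    simpa using isArithmetic_conj_SL2Z (dilateMatrix m hm)⁻¹
  have hF : ⇑((m : ℝ) ^ (1 - k) •
      ModularForm.translate F ((dilateMatrix m hm).map (Rat.castHom ℝ))) = F ∘ dilate m hm := by
    rw [FunLike.coe_smul, coe_translate, slash_dilateMatrix, smul_smul,
      ← zpow_add₀ (by exact_mod_cast hm.ne'), sub_add_sub_cancel, sub_self, zpow_zero, one_smul]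
  rw [← hF]
  exact ModularFormClass.bdd_at_cusps _ ((Subgroup.IsArithmetic.isCusp_iff_isCusp_SL2Z _).mpr hc)

variable (m hm) in
/-- The modular form `F(mτ)` on `Γ₀(m)`, for a modular form `F` of level one. -/
noncomputable def dilateForm (F : ModularForm 𝒮ℒ k) : ModularForm (Gamma0 m) k where
  toFun := F ∘ dilate m hm
  slash_action_eq' := by
    rintro _ ⟨γ, hγ, rfl⟩
    exact comp_dilate_slash_of_mem_Gamma0 F hγ
  holo' := mdifferentiable_comp_dilate F.holo'
  bdd_at_cusps' hc := isBoundedAt_comp_dilate F (hc.mono (Subgroup.map_le_range _ _))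

end Dilation

section Restriction

variable {𝒢 ℋ : Subgroup (GL (Fin 2) ℝ)} {k : ℤ}

/-- A modular form for `ℋ`, regarded as a modular form for a subgroup `𝒢` of `ℋ`. -/
def restrictModularForm (h : 𝒢 ≤ ℋ) (F : ModularForm ℋ k) : ModularForm 𝒢 k where
  toFun := F
  slash_action_eq' γ hγ := F.slash_action_eq' γ (h hγ)
  holo' := F.holo'
  bdd_at_cusps' hc := F.bdd_at_cusps' (hc.mono h)

/-- A cusp form for `ℋ`, regarded as a cusp form for a subgroup `𝒢` of `ℋ`. -/
def restrictCuspForm (h : 𝒢 ≤ ℋ) (F : CuspForm ℋ k) : CuspForm 𝒢 k where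
  toFun := F
  slash_action_eq' γ hγ := F.slash_action_eq' γ (h hγ)
  holo' := F.holo'
  zero_at_cusps' hc := F.zero_at_cusps' (hc.mono h)

end Restriction

section EtaQuotient

variable {ℓ : ℕ} {γ : SL(2, ℤ)}

lemma pow_slash (f : ℍ → ℂ) (k : ℤ) (n : ℕ) (γ : SL(2, ℤ)) :
    (f ^ n) ∣[n * k] γ = (f ∣[k] γ) ^ n := by
  induction n with
  | zero => simpa using ModularForm.is_invariant_one γ
  | succ n ih => rw [pow_succ, pow_succ, ← ih, ← mul_slash_SL2, Nat.cast_succ, add_one_mul]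

lemma sq_modEq_one_of_coprime_six (h6 : ℓ.Coprime 6) : ℓ ^ 2 ≡ 1 [MOD 24] := by
  have hunits : ∀ u : (ZMod 24)ˣ, u ^ 2 = 1 := by decide
  have h24 : ℓ.Coprime 24 := by
    rw [show 24 = 2 * 2 * 6 from rfl]
    have h2 : ℓ.Coprime 2 := h6.coprime_dvd_right (by decide)
    exact (h2.mul_right h2).mul_right h6
  rw [← ZMod.natCast_eq_natCast_iff]
  simpa [Units.ext_iff] using hunits (ZMod.unitOfCoprime ℓ h24)

lemma odd_of_coprime_six (h6 : ℓ.Coprime 6) : Odd ℓ :=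
  Nat.coprime_two_right.mp (h6.coprime_dvd_right (by decide))

lemma hEll_eq_etaSq_pow (hodd : Odd ℓ) (hℓ : 0 < ℓ) :
    hEll ℓ = (etaSq * etaSq ∘ dilate ℓ hℓ) ^ ((ℓ - 1) / 2) := by
  ext τ
  obtain ⟨n, rfl⟩ := hodd
  rw [show (2 * n + 1 - 1) / 2 = n by lia, Pi.pow_apply, Pi.mul_apply, Function.comp_apply, etaSq,
    etaSq, ← mul_pow, ← pow_mul]
  rfl

lemma etaSq_mul_comp_dilate_slash (h6 : ℓ.Coprime 6) (hℓ : 0 < ℓ) (hγ : γ ∈ Gamma0 ℓ) :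
    (etaSq * etaSq ∘ dilate ℓ hℓ) ∣[(2 : ℤ)] γ =
      etaSqCharacter γ ^ (ℓ + 1) • (etaSq * etaSq ∘ dilate ℓ hℓ) := by
  have hsq : (ℓ : ZMod 12) ^ 2 = 1 := by
    exact_mod_cast (ZMod.natCast_eq_natCast_iff (ℓ ^ 2) 1 12).mpr
      ((sq_modEq_one_of_coprime_six h6).of_dvd (by decide))
  obtain ⟨γ', h⟩ := exists_isDiagConj hγ
  rw [show (2 : ℤ) = 1 + 1 from rfl, mul_slash_SL2, h.comp_dilate_slash, etaSq_slash, etaSq_slash,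
    h.etaSqCharacter_eq hsq]
  ext τ
  simp only [Pi.mul_apply, Pi.smul_apply, Function.comp_apply, smul_eq_mul]
  ring

lemma sub_one_eq_half_mul_two (hodd : Odd ℓ) : (ℓ : ℤ) - 1 = ((ℓ - 1) / 2 : ℕ) * 2 := by
  obtain ⟨n, rfl⟩ := hodd
  lia

lemma twelve_dvd_of_coprime_six (h6 : ℓ.Coprime 6) : 12 ∣ (ℓ + 1) * ((ℓ - 1) / 2) := by
  have hodd := odd_of_coprime_six h6
  have h24 : 24 ∣ ℓ ^ 2 - 1 ^ 2 := (Nat.modEq_iff_dvd' (Nat.pow_le_pow_left hodd.pos 2)).mp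
    (sq_modEq_one_of_coprime_six h6).symm
  rw [Nat.sq_sub_sq, ← Nat.two_mul_div_two_of_even (hodd.tsub_odd odd_one), mul_left_comm] at h24
  exact Nat.dvd_of_mul_dvd_mul_left two_pos h24

lemma hEll_slash_of_mem_Gamma0 (h6 : ℓ.Coprime 6) (hγ : γ ∈ Gamma0 ℓ) :
    hEll ℓ ∣[(ℓ : ℤ) - 1] γ = hEll ℓ := by
  have hodd := odd_of_coprime_six h6
  have hχ : (etaSqCharacter γ ^ (ℓ + 1)) ^ ((ℓ - 1) / 2) = 1 := by
    obtain ⟨c, hc⟩ := twelve_dvd_of_coprime_six h6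
    rw [← pow_mul, hc, pow_mul, etaSqCharacter_pow_twelve, one_pow]
  rw [hEll_eq_etaSq_pow hodd hodd.pos, sub_one_eq_half_mul_two hodd, pow_slash,
    etaSq_mul_comp_dilate_slash h6 _ hγ, smul_pow, hχ, one_smul]

lemma mdifferentiable_eta : MDiff (fun τ : ℍ ↦ ModularForm.eta τ) := by
  rw [UpperHalfPlane.mdifferentiable_iff]
  refine .congr (fun z hz ↦
    (differentiableAt_eta_of_mem_upperHalfPlaneSet hz).differentiableWithinAt) fun z hz ↦ ?_
  simp [ofComplex_apply_of_im_pos hz]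

lemma mdifferentiable_hEll (hℓ : 0 < ℓ) : MDiff (hEll ℓ) :=
  (mdifferentiable_eta.mul (mdifferentiable_comp_dilate (hm := hℓ) mdifferentiable_eta)).pow (ℓ - 1)

variable (ℓ) in
lemma hEll_pow_twentyFour (hℓ : 0 < ℓ) :
    hEll ℓ ^ 24 =
      (ModularForm.discriminant * ModularForm.discriminant ∘ dilate ℓ hℓ) ^ (ℓ - 1) := by
  ext τ
  simp only [Pi.pow_apply, Pi.mul_apply, Function.comp_apply, hEll, ModularForm.discriminant,
    coe_dilate]
  ring

lemma isZeroAtImInfty_of_pow {f : ℍ → ℂ} {n : ℕ} (h : IsZeroAtImInfty (f ^ n)) :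
    IsZeroAtImInfty f := by
  refine Metric.tendsto_nhds.mpr fun ε hε ↦ ?_
  filter_upwards [Metric.tendsto_nhds.mp h (ε ^ n) (by positivity)] with τ hτ
  rw [dist_zero_right] at hτ ⊢
  rw [Pi.pow_apply, norm_pow] at hτ
  exact lt_of_pow_lt_pow_left₀ n hε.le hτ

lemma isZeroAtImInfty_hEll_slash (hℓ : 1 < ℓ) (γ : SL(2, ℤ)) :
    IsZeroAtImInfty (hEll ℓ ∣[(ℓ : ℤ) - 1] γ) := by
  have hpos : 0 < ℓ := by lia
  have : NeZero ℓ := ⟨hpos.ne'⟩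
  let D : CuspForm (Gamma0 ℓ) (12 + 12) :=
    (restrictCuspForm (Subgroup.map_le_range _ _) CuspForm.discriminant).mulModularForm
      (dilateForm ℓ hpos (CuspForm.discriminant : ModularForm 𝒮ℒ 12))
  have hD : ⇑D = ModularForm.discriminant * ModularForm.discriminant ∘ dilate ℓ hpos := rfl
  have hslash : (hEll ℓ ∣[(ℓ : ℤ) - 1] γ) ^ 24 = (⇑D ∣[(12 + 12 : ℤ)] γ) ^ (ℓ - 1) := by
    rw [← pow_slash, ← pow_slash, hEll_pow_twentyFour ℓ hpos, hD]
    congr 1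
    lia
  refine isZeroAtImInfty_of_pow (n := 24) ?_
  have hlim := (CuspFormClass.zero_at_infty_slash D γ).pow (ℓ - 1)
  rw [zero_pow (by lia)] at hlim
  rw [hslash]
  exact hlim

/-- The eta quotient `h_ℓ` as a cusp form of weight `ℓ - 1` on `Γ₀(ℓ)`. -/
noncomputable def hEllForm (hℓ : 1 < ℓ) (h6 : ℓ.Coprime 6) : CuspForm (Gamma0 ℓ) ((ℓ : ℤ) - 1) where
  toFun := hEll ℓ
  slash_action_eq' := by
    rintro _ ⟨γ, hγ, rfl⟩
    exact hEll_slash_of_mem_Gamma0 h6 hγ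
  holo' := mdifferentiable_hEll (by lia)
  zero_at_cusps' hc :=
    (OnePoint.isZeroAt_iff_forall_SL2Z (hc.mono (Subgroup.map_le_range _ _))).mpr
      fun γ _ ↦ isZeroAtImInfty_hEll_slash hℓ γ

end EtaQuotient

section Trace

variable {p : ℕ} {γ γ' : SL(2, ℤ)} {K : ℤ}

lemma mul_inv_mem_Gamma0_iff :
    γ * γ'⁻¹ ∈ Gamma0 p ↔ (γ 1 0 : ZMod p) * γ' 1 1 = γ 1 1 * γ' 1 0 := by
  rw [Gamma0_mem, ← sub_eq_zero (a := (γ 1 0 : ZMod p) * γ' 1 1)]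
  simp [Matrix.SpecialLinearGroup.coe_mul, Matrix.SpecialLinearGroup.coe_inv,
    Matrix.adjugate_fin_two, Matrix.mul_apply, Fin.sum_univ_two, sub_eq_add_neg]

variable (p) in
/-- Representatives of `Γ₀(p) \ SL(2, ℤ)` for a prime `p`: the bottom rows of `1` and of `S T ^ j`
are `(0, 1)` and `(1, j)`, and these represent the points of the projective line over `ZMod p`. -/
def gamma0CosetRep : Option (ZMod p) → SL(2, ℤ)
  | none => 1
  | some j => ModularGroup.S * ModularGroup.T ^ (j.val : ℤ)

lemma gamma0CosetRep_none_mul_inv_mem_iff :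
    gamma0CosetRep p none * γ⁻¹ ∈ Gamma0 p ↔ (γ 1 0 : ZMod p) = 0 := by
  rw [mul_inv_mem_Gamma0_iff]
  simp [gamma0CosetRep, eq_comm]

lemma gamma0CosetRep_some_mul_inv_mem_iff [NeZero p] (j : ZMod p) :
    gamma0CosetRep p (some j) * γ⁻¹ ∈ Gamma0 p ↔ (γ 1 1 : ZMod p) = j * γ 1 0 := by
  rw [mul_inv_mem_Gamma0_iff]
  simp [gamma0CosetRep, Matrix.SpecialLinearGroup.coe_mul, ModularGroup.coe_S,
    ModularGroup.coe_T_zpow]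

lemma existsUnique_gamma0CosetRep_mul_inv_mem [Fact p.Prime] (γ : SL(2, ℤ)) :
    ∃! i, gamma0CosetRep p i * γ⁻¹ ∈ Gamma0 p := by
  by_cases hγ : (γ 1 0 : ZMod p) = 0
  · refine ⟨none, gamma0CosetRep_none_mul_inv_mem_iff.mpr hγ, ?_⟩
    rintro (- | j) hj
    · rfl
    · have hdet : ((γ 0 0 * γ 1 1 - γ 0 1 * γ 1 0 : ℤ) : ZMod p) = 1 := by
        rw [← Matrix.det_fin_two, γ.det_coe, Int.cast_one]
      rw [gamma0CosetRep_some_mul_inv_mem_iff, hγ, mul_zero] at hj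
      simp [hγ, hj] at hdet
  · refine ⟨some (γ 1 1 / γ 1 0),
      (gamma0CosetRep_some_mul_inv_mem_iff _).mpr (div_mul_cancel₀ _ hγ).symm, ?_⟩
    rintro (- | j) hj
    · exact absurd (gamma0CosetRep_none_mul_inv_mem_iff.mp hj) hγ
    · rw [gamma0CosetRep_some_mul_inv_mem_iff] at hj
      rw [hj, mul_div_cancel_right₀ _ hγ]

variable (p) in
/-- The left coset in `SL(2, ℤ) / Γ₀(p)` of the inverse of `gamma0CosetRep p i`, formed in
`GL(2, ℝ)` because the trace of modular forms is a sum over such cosets. -/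
def gamma0Coset (i : Option (ZMod p)) : 𝒮ℒ ⧸ (Gamma0 p : Subgroup (GL (Fin 2) ℝ)).subgroupOf 𝒮ℒ :=
  ⟦(⟨gamma0CosetRep p i, ⟨_, rfl⟩⟩ : 𝒮ℒ)⁻¹⟧

lemma gamma0Coset_bijective [Fact p.Prime] : Function.Bijective (gamma0Coset p) := by
  rw [Function.bijective_iff_existsUnique]
  rintro ⟨_, γ, rfl⟩
  refine (existsUnique_congr fun i ↦ ?_).mpr (existsUnique_gamma0CosetRep_mul_inv_mem γ⁻¹)
  refine QuotientGroup.eq.trans ?_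
  rw [inv_inv, inv_inv, Subgroup.mem_subgroupOf]
  refine Iff.trans ?_ (Subgroup.mem_map_iff_mem
    (Matrix.SpecialLinearGroup.mapGL_injective (R := ℤ) (S := ℝ)))
  rw [map_mul]
  rfl

lemma coe_trace_Gamma0 [Fact p.Prime] (f : CuspForm (Gamma0 p) K) :
    ⇑(CuspForm.trace 𝒮ℒ f) =
      ⇑f + ∑ j : ZMod p, ⇑f ∣[K] (ModularGroup.S * ModularGroup.T ^ (j.val : ℤ)) := by
  let := Fintype.ofFinite (𝒮ℒ ⧸ (Gamma0 p : Subgroup (GL (Fin 2) ℝ)).subgroupOf 𝒮ℒ)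
  have hcoset (i : Option (ZMod p)) : SlashInvariantForm.quotientFunc f (gamma0Coset p i) =
      ⇑f ∣[K] gamma0CosetRep p i := by
    rw [gamma0Coset]
    exact congrArg (⇑f ∣[K] ·) (inv_inv (gamma0CosetRep p i : GL (Fin 2) ℝ))
  calc ⇑(CuspForm.trace 𝒮ℒ f) = ∑ q, SlashInvariantForm.quotientFunc f q := CuspForm.coe_trace 𝒮ℒ f
    _ = ∑ i, SlashInvariantForm.quotientFunc f (gamma0Coset p i) :=
      (gamma0Coset_bijective.sum_comp _).symm
    _ = _ := by
      simp_rw [hcoset]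
      rw [Fintype.sum_option, gamma0CosetRep, SlashAction.slash_one]
      rfl

end Trace

section UOperator

/-- The point `τ / m` of the upper half plane, for a positive integer `m`. -/
noncomputable def shrink (m : ℕ) (hm : 0 < m) (τ : ℍ) : ℍ :=
  ⟨(τ : ℂ) / m, by
    rw [Complex.div_natCast_im]
    exact div_pos τ.im_pos (Nat.cast_pos.mpr hm)⟩

/-- The operator `U(m)` on functions of period `1`, as an average over the points `(τ + j) / m`. -/
noncomputable def averageU (m : ℕ) [NeZero m] (f : ℍ → ℂ) (τ : ℍ) : ℂ :=
  (m : ℂ)⁻¹ * ∑ j : ZMod m, f (shrink m (NeZero.pos m) (((j.val : ℤ) : ℝ) +ᵥ τ))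

variable {m : ℕ} {hm : 0 < m}

lemma coe_shrink (τ : ℍ) : (shrink m hm τ : ℂ) = τ / m := rfl

lemma qParam_shrink_pow (τ : ℍ) :
    Function.Periodic.qParam 1 (shrink m hm τ : ℂ) ^ m = Function.Periodic.qParam 1 (τ : ℂ) := by
  have hm₀ : (m : ℂ) ≠ 0 := by exact_mod_cast hm.ne'
  rw [Function.Periodic.qParam, Function.Periodic.qParam, ← Complex.exp_nat_mul, coe_shrink]
  congr 1
  field_simp

lemma qParam_shrink_vadd [NeZero m] (j : ZMod m) (τ : ℍ) :
    Function.Periodic.qParam 1 (shrink m hm (((j.val : ℤ) : ℝ) +ᵥ τ) : ℂ) =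
      ZMod.stdAddChar j * Function.Periodic.qParam 1 (shrink m hm τ : ℂ) := by
  have hj := ZMod.stdAddChar_coe (N := m) j.val
  rw [Int.cast_natCast, ZMod.natCast_zmod_val] at hj
  rw [hj, Function.Periodic.qParam, Function.Periodic.qParam, ← Complex.exp_add, coe_shrink,
    coe_shrink, coe_vadd]
  congr 1
  push_cast
  ring

lemma sum_stdAddChar_pow [NeZero m] (n : ℕ) :
    ∑ j : ZMod m, (ZMod.stdAddChar j : ℂ) ^ n = if m ∣ n then (m : ℂ) else 0 := by
  have hchar (j : ZMod m) : (ZMod.stdAddChar j : ℂ) ^ n = ZMod.stdAddChar (j * (n : ZMod m)) := by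
    rw [← AddChar.map_nsmul_eq_pow, nsmul_eq_mul, mul_comm]
  simp_rw [hchar]
  rw [AddChar.sum_mulShift _ (ZMod.isPrimitive_stdAddChar m), ZMod.card]
  simp only [ZMod.natCast_eq_zero_iff, Nat.cast_ite, Nat.cast_zero]

lemma averageU_qParam_pow [NeZero m] (τ : ℍ) (n : ℕ) :
    averageU m (fun τ ↦ Function.Periodic.qParam 1 (τ : ℂ) ^ n) τ =
      if m ∣ n then Function.Periodic.qParam 1 (τ : ℂ) ^ (n / m) else 0 := by
  simp_rw [averageU, qParam_shrink_vadd, mul_pow]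
  rw [← Finset.sum_mul, sum_stdAddChar_pow]
  split_ifs with h
  · obtain ⟨c, rfl⟩ := h
    rw [Nat.mul_div_cancel_left _ (NeZero.pos m), pow_mul, qParam_shrink_pow,
      inv_mul_cancel_left₀ (NeZero.ne _)]
  · simp

lemma HasQExpansion.averageU [NeZero m] {f : ℍ → ℂ} {p : PowerSeries ℂ} (hf : HasQExpansion f p) :
    HasQExpansion (averageU m f) (powerSeriesU m p) := by
  intro τ
  have hsum := (hasSum_sum (s := Finset.univ) fun (j : ZMod m) (_ : j ∈ Finset.univ) ↦
    hf (shrink m (NeZero.pos m) (((j.val : ℤ) : ℝ) +ᵥ τ))).mul_left (m : ℂ)⁻¹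
  have hterm (n : ℕ) : (m : ℂ)⁻¹ * ∑ j : ZMod m, p.coeff n * Function.Periodic.qParam 1
      (shrink m (NeZero.pos m) (((j.val : ℤ) : ℝ) +ᵥ τ) : ℂ) ^ n =
      if m ∣ n then p.coeff n * Function.Periodic.qParam 1 (τ : ℂ) ^ (n / m) else 0 := by
    rw [← Finset.mul_sum, mul_left_comm, ← mul_ite_zero, ← averageU_qParam_pow, _root_.averageU]
  simp_rw [hterm] at hsum
  rw [← (mul_right_injective₀ (NeZero.ne m)).hasSum_iff] at hsum
  · refine hsum.congr_fun fun n ↦ ?_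
    simp [powerSeriesU, NeZero.pos m]
  · rintro n hn
    rw [if_neg]
    rintro ⟨c, rfl⟩
    exact hn ⟨c, rfl⟩

end UOperator

section Inversion

variable {m : ℕ} {hm : 0 < m} {k : ℤ}

lemma dilate_shrink (τ : ℍ) : dilate m hm (shrink m hm τ) = τ := by
  have hm₀ : (m : ℂ) ≠ 0 := by exact_mod_cast hm.ne'
  ext
  rw [coe_dilate, coe_shrink, mul_div_cancel₀ _ hm₀]

lemma dilate_S_smul (τ : ℍ) :
    dilate m hm (ModularGroup.S • τ) = ModularGroup.S • shrink m hm τ := by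
  ext
  rw [modular_S_smul, modular_S_smul]
  simp [dilate, shrink, div_eq_mul_inv]

lemma comp_dilate_slash_S (f : ℍ → ℂ) :
    (f ∘ dilate m hm) ∣[k] ModularGroup.S =
      ((m : ℂ) ^ k)⁻¹ • (f ∣[k] ModularGroup.S) ∘ shrink m hm := by
  have hm₀ : (m : ℂ) ≠ 0 := by exact_mod_cast hm.ne'
  ext τ
  have := τ.ne_zero
  simp only [SL_slash_apply, Function.comp_apply, dilate_S_smul, Pi.smul_apply, smul_eq_mul]
  rw [ModularGroup.denom_S, ModularGroup.denom_S, coe_shrink, zpow_neg, zpow_neg, div_zpow]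
  field_simp

lemma slash_T_zpow (f : ℍ → ℂ) (n : ℤ) (τ : ℍ) :
    (f ∣[k] (ModularGroup.T ^ n)) τ = f ((n : ℝ) +ᵥ τ) := by
  have hd : denom (ModularGroup.T ^ n : SL(2, ℤ)) τ = 1 := by
    rw [ModularGroup.denom_apply]
    simp [ModularGroup.coe_T_zpow]
  rw [SL_slash_apply, hd, one_zpow, mul_one, modular_T_zpow_smul]

variable {ℓ : ℕ}

lemma hEll_slash_S (hodd : Odd ℓ) :
    hEll ℓ ∣[(ℓ : ℤ) - 1] ModularGroup.S =
      (-(ℓ : ℂ)⁻¹) ^ ((ℓ - 1) / 2) • hEll ℓ ∘ shrink ℓ hodd.pos := by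
  have hprod : (etaSq * etaSq ∘ dilate ℓ hodd.pos) ∣[(2 : ℤ)] ModularGroup.S =
      -(ℓ : ℂ)⁻¹ • (etaSq * etaSq ∘ dilate ℓ hodd.pos) ∘ shrink ℓ hodd.pos := by
    rw [show (2 : ℤ) = 1 + 1 from rfl, mul_slash_SL2, comp_dilate_slash_S, etaSq_slash_S,
      etaSqCharacter_S]
    ext τ
    simp only [Pi.mul_apply, Pi.smul_apply, Function.comp_apply, smul_eq_mul, dilate_shrink,
      zpow_one]
    linear_combination (ℓ : ℂ)⁻¹ * etaSq τ * etaSq (shrink ℓ hodd.pos τ) * Complex.I_sq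
  rw [sub_one_eq_half_mul_two hodd, hEll_eq_etaSq_pow hodd hodd.pos, pow_slash, hprod, smul_pow]
  rfl

end Inversion

section EtaQuotientTimesForm

variable {ℓ : ℕ} {k : ℤ}

lemma one_mem_strictPeriods_Gamma0 (N : ℕ) :
    (1 : ℝ) ∈ (Gamma0 N : Subgroup (GL (Fin 2) ℝ)).strictPeriods := by
  rw [strictPeriods_Gamma0]
  exact AddSubgroup.mem_zmultiples 1

lemma hasQExpansion_of_cuspForm_Gamma0 {N : ℕ} [NeZero N] (f : CuspForm (Gamma0 N) k) :
    HasQExpansion f (qExpansion 1 f) :=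
  ModularForm.hasSum_qExpansion f one_pos (one_mem_strictPeriods_Gamma0 N)

/-- The cusp form `h_ℓ(τ) F(ℓτ)` on `Γ₀(ℓ)`. -/
noncomputable def hEllMulDilate (hℓ : 1 < ℓ) (h6 : ℓ.Coprime 6) (F : ModularForm 𝒮ℒ k) :
    CuspForm (Gamma0 ℓ) (k + ℓ - 1) :=
  .mcast (by ring) ((hEllForm hℓ h6).mulModularForm (dilateForm ℓ (by lia) F))

lemma hEllMulDilate_apply (hℓ : 1 < ℓ) (h6 : ℓ.Coprime 6) (F : ModularForm 𝒮ℒ k) (τ : ℍ) :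
    hEllMulDilate hℓ h6 F τ = hEll ℓ τ * F (dilate ℓ (by lia) τ) :=
  rfl

lemma hasQExpansion_hEll_mul (hℓ : 1 < ℓ) (h6 : ℓ.Coprime 6) (F : ModularForm 𝒮ℒ k) :
    HasQExpansion (fun τ ↦ hEll ℓ τ * F τ) (qExpansion 1 (fun τ ↦ hEll ℓ τ * F τ)) :=
  have : NeZero ℓ := ⟨by lia⟩
  hasQExpansion_of_cuspForm_Gamma0
    ((hEllForm hℓ h6).mulModularForm (restrictModularForm (Subgroup.map_le_range _ _) F))

lemma hEllMulDilate_slash_S (hℓ : 1 < ℓ) (h6 : ℓ.Coprime 6) (F : ModularForm 𝒮ℒ k) :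
    ⇑(hEllMulDilate hℓ h6 F) ∣[k + ℓ - 1] ModularGroup.S =
      ((-(ℓ : ℂ)⁻¹) ^ ((ℓ - 1) / 2) * ((ℓ : ℂ) ^ k)⁻¹) •
        (fun τ ↦ hEll ℓ τ * F τ) ∘ shrink ℓ (by lia) := by
  have hF : ⇑F ∣[k] ModularGroup.S = F := SlashInvariantFormClass.slash_action_eq F _ ⟨_, rfl⟩
  have hcoe : ⇑(hEllMulDilate hℓ h6 F) = hEll ℓ * F ∘ dilate ℓ (by lia) :=
    funext (hEllMulDilate_apply hℓ h6 F)
  rw [hcoe, show k + ℓ - 1 = (ℓ - 1) + k by ring, mul_slash_SL2, comp_dilate_slash_S, hF,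
    hEll_slash_S (odd_of_coprime_six h6), smul_mul_smul_comm]
  rfl

lemma sum_hEllMulDilate_slash [NeZero ℓ] (hℓ : 1 < ℓ) (h6 : ℓ.Coprime 6) (F : ModularForm 𝒮ℒ k) :
    ∑ j : ZMod ℓ, ⇑(hEllMulDilate hℓ h6 F) ∣[k + ℓ - 1]
        (ModularGroup.S * ModularGroup.T ^ (j.val : ℤ)) =
      ((-(ℓ : ℂ)⁻¹) ^ ((ℓ - 1) / 2) * (ℓ : ℂ) ^ (1 - k)) •
        averageU ℓ (fun τ ↦ hEll ℓ τ * F τ) := by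
  have hℓ₀ : (ℓ : ℂ) ≠ 0 := NeZero.ne _
  ext τ
  simp only [Finset.sum_apply, SlashAction.slash_mul, slash_T_zpow, hEllMulDilate_slash_S,
    Pi.smul_apply, Function.comp_apply, smul_eq_mul, averageU]
  rw [← Finset.mul_sum, zpow_sub₀ hℓ₀, zpow_one]
  field_simp

lemma neg_one_pow_mul_pow_mul_zpow_eq_one {K : Type*} [Field K] {x : K} (hx : x ≠ 0) (k : ℕ)
    {n : ℕ} (hn : 1 ≤ n) :
    ((-1) ^ n * x ^ (k + n - 1)) * ((-x⁻¹) ^ n * x ^ (1 - k : ℤ)) = 1 := by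
  have hpow : x ^ (k + n - 1) * x ^ (1 - k : ℤ) = x ^ n := by
    rw [← zpow_natCast, ← zpow_natCast, ← zpow_add₀ hx]
    congr 1
    lia
  calc _ = (-1 * -x⁻¹) ^ n * (x ^ (k + n - 1) * x ^ (1 - k : ℤ)) := by rw [mul_pow]; ring
    _ = 1 := by rw [hpow, ← mul_pow, neg_one_mul, neg_neg, inv_mul_cancel₀ hx, one_pow]

end EtaQuotientTimesForm

theorem proposition3p3 (ℓ : ℕ) (hℓ : ℓ.Prime) (hℓ3 : 3 < ℓ) (k : ℕ) (hk : Even k)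
    (F : ModularForm 𝒮ℒ (k : ℤ)) :
    -- the product `h_ℓ F` has a convergent `q`-expansion in nonnegative powers of `q`,
    HasQExpansion (fun τ ↦ hEll ℓ τ * F τ) (qExpansion 1 (fun τ ↦ hEll ℓ τ * F τ)) ∧
    -- applying `U(ℓ)` to it gives the `q`-expansion of a function `gU` on the upper half plane,
    ∃ gU : ℍ → ℂ,
      HasQExpansion gU (powerSeriesU ℓ (qExpansion 1 (fun τ ↦ hEll ℓ τ * F τ))) ∧
      -- and the stated combination is a cusp form of level one and weight `k + ℓ - 1`.
      ∃ G : CuspForm 𝒮ℒ ((k : ℤ) + (ℓ : ℤ) - 1), ∀ τ : ℍ,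
        G τ = gU τ + (-1 : ℂ) ^ ((ℓ - 1) / 2) * (ℓ : ℂ) ^ (k + (ℓ - 1) / 2 - 1) *
          hEll ℓ τ * F (dilate ℓ hℓ.pos τ) := by
  have : Fact ℓ.Prime := ⟨hℓ⟩
  have h6 : ℓ.Coprime 6 := (Nat.coprime_primes hℓ Nat.prime_two).mpr (by lia) |>.mul_right
    ((Nat.coprime_primes hℓ Nat.prime_three).mpr (by lia))
  have hq := hasQExpansion_hEll_mul hℓ.one_lt h6 F
  set n := (ℓ - 1) / 2
  set c : ℂ := (-1) ^ n * (ℓ : ℂ) ^ (k + n - 1)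
  have hc : c * ((-(ℓ : ℂ)⁻¹) ^ n * (ℓ : ℂ) ^ (1 - k : ℤ)) = 1 :=
    neg_one_pow_mul_pow_mul_zpow_eq_one (NeZero.ne _) k (by lia)
  refine ⟨hq, _, hq.averageU, c • CuspForm.trace 𝒮ℒ (hEllMulDilate hℓ.one_lt h6 F), fun τ ↦ ?_⟩
  rw [smul_apply, coe_trace_Gamma0, sum_hEllMulDilate_slash, Pi.add_apply, smul_add, Pi.smul_apply,
    smul_smul, hc, one_smul, add_comm, smul_eq_mul, hEllMulDilate_apply, mul_assoc c]
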